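/- \textbf{Setting.} There are $n$ buyers, buyer $i$ having a private valuation $v_i$ for a service that can be allocated to at most $k$ buyers; $\vec v=(v_1,\dots,v_n)$ is drawn from a known distribution $\pi$. A buyer served with $x_i\in\{0,1\}$ and paying $p_i\ge 0$ has utility $x_iv_i-p_i$. A \emph{randomized direct revelation mechanism} is a (measurable) probability distribution over maps from reported valuation vectors (reports lying in the supports of the marginals $\pi_i$) to allocations in $\{0,1\}^n$ with at most $k$ ones and payments in $\mathbb{R}_{\ge 0}^n$; $x_i(\vec s)$ and $p_i(\vec s)$ denote the expected allocation and the (finite) expected payment at the reports $\vec s$. It is \emph{dominant strategy IC} if $x_i(v_i,\vec s_{-i})v_i-p_i(v_i,\vec s_{-i})\ge x_i(\vec s)v_i-p_i(\vec s)$ for all $i$, all $\vec s\in\prod_j\operatorname{supp}(\pi_j)$ and all $\vec v\in\operatorname{supp}(\pi)$, and \emph{ex-post IR} if $x_i(\vec v)v_i-p_i(\vec v)\ge 0$ for all $i$ and all $\vec v\in\operatorname{supp}(\pi)$. Let $\mathrm{OPT}(\pi,k)$ be the supremum of $\mathbf{E}_{\vec v\sim\pi}[\sum_i p_i(\vec v)]$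 over all dominant strategy IC, ex-post IR mechanisms. A \emph{sequential posted price mechanism} repeatedly selects a buyer not selected before and proposes to him a price $p\ge 0$; the choice of the buyer and of the price may be randomized (independently of $\vec v$) and may depend on the earlier responses. The selected buyer $i$ accepts, and pays $p$, if and only if $p\le v_i$. The process ends once $k$ buyers have accepted or all buyers have been selected; the revenue is the sum of the payments. \textbf{Theorem.} For every integer $n\ge 2$ and every real $\alpha>0$ there is a probability distribution $\pi$ on $[0,1]^n$ with a density $f$ such that \begin{enumerate} \item the support of $\pi$ is $[0,1]^n$; \item $\mathbf{E}_{\vec v\sim\pi}[v_i]$ is finite for every $i$; \item $f$ is symmetric in its arguments on $[0,1]^n$; \item $f$ is continuous and everywhere positive on $[0,1]^n$; \item for every $i$ and $\vec v_{-i}\in[0,1]^{n-1}$ the conditional density $f_i(x\mid\vec v_{-i})=f(x,\vec v_{-i})/\int_0^1 f(t,\vec v_{-i})\,dt$ is positive for all $x\in[0,1]$; \item $\pi$ has monotone hazard rate and is regular: for every $i$ and $\vec v_{-i}\in[0,1]^{n-1}$, the function $x\mapsto\bigl(1-F_i(x\mid\vec v_{-i})\bigr)/f_i(x\mid\vec v_{-i})$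 with $F_i(x\mid\vec v_{-i})=\int_0^x f_i(t\mid\vec v_{-i})\,dt$ is non-increasing on $[0,1]$, and the virtual value $x\mapsto-\bigl(\tfrac{d}{dx}B_i(x\mid\vec v_{-i})\bigr)/f_i(x\mid\vec v_{-i})$ with $B_i(x\mid\vec v_{-i})=x\int_x^1 f_i(t\mid\vec v_{-i})\,dt$ is non-decreasing on $[0,1]$ (one-sided derivatives at the endpoints); \item $\pi$ is affiliated: $f(\vec v\wedge\vec w)f(\vec v\vee\vec w)\ge f(\vec v)f(\vec w)$ for all $\vec v,\vec w\in[0,1]^n$, with componentwise minimum $\wedge$ and maximum $\vee$; \end{enumerate} and such that, for every $k\ge 1$, every sequential posted price mechanism with supply $k$ has expected revenue strictly less than $\alpha\cdot\mathrm{OPT}(\pi,k)$. -/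

import Mathlib

open MeasureTheory Set
open scoped ENNReal

noncomputable section

namespace Posted

/-! ### Mechanisms with `n` buyers and `k` units of the service -/

/-- A randomized direct revelation mechanism for `n` buyers that may serve at most `k` of them: a
random seed `ω`, drawn from the probability space `(Ω, P)`, selects the deterministic mechanism
`s ↦ (alloc ω s, pay ω s)`, with `alloc ω s` a `(0,1)`-vector and `pay ω s` a vector of nonnegative
payments. Only reports in the supports of the marginals of the valuation distribution matter
below: the values at other reports occur in no requirement on incentives and not in the revenue. -/
structure DirectMechanism (n k : ℕ) where
  Ω : Type
  [mΩ : MeasurableSpace Ω]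
  P : Measure Ω
  [prob : IsProbabilityMeasure P]
  alloc : Ω → (Fin n → ℝ) → Fin n → ℝ
  pay : Ω → (Fin n → ℝ) → Fin n → ℝ
  alloc_zero_or_one : ∀ ω s i, alloc ω s i = 0 ∨ alloc ω s i = 1
  alloc_le : ∀ ω s, ∑ i, alloc ω s i ≤ (k : ℝ)
  pay_nonneg : ∀ ω s i, 0 ≤ pay ω s i
  measurable_alloc : ∀ i, Measurable fun q : Ω × (Fin n → ℝ) => alloc q.1 q.2 i
  measurable_pay : ∀ i, Measurable fun q : Ω × (Fin n → ℝ) => pay q.1 q.2 i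
  integrable_pay : ∀ s i, Integrable (fun ω => pay ω s i) P

attribute [instance] DirectMechanism.mΩ DirectMechanism.prob

namespace DirectMechanism

variable {n k : ℕ}

/-- The expected allocation `x_i(s)`. -/
def expAlloc (M : DirectMechanism n k) (s : Fin n → ℝ) (i : Fin n) : ℝ :=
  ∫ ω, M.alloc ω s i ∂M.P

/-- The expected payment `p_i(s)`. -/
def expPay (M : DirectMechanism n k) (s : Fin n → ℝ) (i : Fin n) : ℝ :=
  ∫ ω, M.pay ω s i ∂M.P

/-- Dominant strategy incentive compatibility: whatever the others report, reporting the true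
valuation `v i` is at least as good for buyer `i` as reporting `s i`. -/
def IsDSIC (M : DirectMechanism n k) (π : Measure (Fin n → ℝ)) : Prop :=
  ∀ (i : Fin n) (s v : Fin n → ℝ),
    (∀ j, s j ∈ (π.map fun w => w j).support) → v ∈ π.support →
      M.expAlloc s i * v i - M.expPay s i ≤
        M.expAlloc (Function.update s i (v i)) i * v i -
          M.expPay (Function.update s i (v i)) i

/-- Ex-post individual rationality: truthful reporting never gives a negative utility. -/
def IsExPostIR (M : DirectMechanism n k) (π : Measure (Fin n → ℝ)) : Prop :=
  ∀ (i : Fin n) (v : Fin n → ℝ), v ∈ π.support → 0 ≤ M.expAlloc v i * v i - M.expPay v i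

/-- The expected revenue under truthful reports drawn from `π`. -/
def revenue (M : DirectMechanism n k) (π : Measure (Fin n → ℝ)) : ℝ≥0∞ :=
  ∫⁻ v, ENNReal.ofReal (∑ i, M.expPay v i) ∂π

end DirectMechanism

/-- The optimal expected revenue of a dominant strategy IC, ex-post IR mechanism for the instance
`(n, π, k)`. -/
def optimalRevenue {n : ℕ} (π : Measure (Fin n → ℝ)) (k : ℕ) : ℝ≥0∞ :=
  ⨆ (M : DirectMechanism n k) (_ : M.IsDSIC π) (_ : M.IsExPostIR π), M.revenue π

/-- A (randomized, adaptive) sequential posted price mechanism for `n` buyers. A history is the list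
of the responses received so far, oldest first (`true` for acceptance). After history `h`, with
random seed `ω`, the mechanism selects the buyer `buyer ω h` and proposes the price `price ω h` to
him. Given the seed, a history determines the buyers and prices selected earlier (those at its
proper prefixes), and no buyer is selected twice. -/
structure SequentialPostedPrice (n : ℕ) where
  Ω : Type
  [mΩ : MeasurableSpace Ω]
  P : Measure Ω
  [prob : IsProbabilityMeasure P]
  buyer : Ω → List Bool → Fin n
  price : Ω → List Bool → ℝ
  price_nonneg : ∀ ω h, 0 ≤ price ω h
  buyer_fresh : ∀ ω (h : List Bool) (t : ℕ), h.length < n → t < h.length →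
    buyer ω h ≠ buyer ω (h.take t)
  measurable_buyer : ∀ h, Measurable fun ω => buyer ω h
  measurable_price : ∀ h, Measurable fun ω => price ω h

attribute [instance] SequentialPostedPrice.mΩ SequentialPostedPrice.prob

namespace SequentialPostedPrice

variable {n : ℕ}

/-- With valuations `v`, the buyer selected after history `h` accepts: the proposed price does not
exceed his valuation. -/
def Accepts (M : SequentialPostedPrice n) (ω : M.Ω) (v : Fin n → ℝ) (h : List Bool) : Prop :=
  M.price ω h ≤ v (M.buyer ω h)

open scoped Classical in
/-- The responses in the first `t` iterations when the valuations are `v`. (Iterations after the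
termination of the process are only hypothetical; they do not count in `runRevenue`.) -/
def history (M : SequentialPostedPrice n) (ω : M.Ω) (v : Fin n → ℝ) : ℕ → List Bool
  | 0 => []
  | t + 1 => M.history ω v t ++ [decide (M.Accepts ω v (M.history ω v t))]

open scoped Classical in
/-- The sum of the payments with seed `ω` and valuations `v`: in each of at most `n` iterations, as
long as fewer than `k` offers have been accepted, the selected buyer pays the price if he accepts. -/
def runRevenue (M : SequentialPostedPrice n) (k : ℕ) (ω : M.Ω) (v : Fin n → ℝ) : ℝ :=
  ∑ t ∈ Finset.range n,
    if (M.history ω v t).count true < k ∧ M.Accepts ω v (M.history ω v t) then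
      M.price ω (M.history ω v t)
    else 0

/-- The expected revenue on the instance `(n, π, k)`. -/
def revenue (M : SequentialPostedPrice n) (π : Measure (Fin n → ℝ)) (k : ℕ) : ℝ≥0∞ :=
  ∫⁻ v, ∫⁻ ω, ENNReal.ofReal (M.runRevenue k ω v) ∂M.P ∂π

end SequentialPostedPrice

/-! ### Valuation distributions on the unit cube -/

/-- The cube `[0,1]^n`. -/
def cube (n : ℕ) : Set (Fin n → ℝ) := Icc 0 1

variable {n : ℕ}

/-- `f` is a density of `π`, which lives on `[0,1]^n`. -/
def HasDensityOnCube (π : Measure (Fin n → ℝ)) (f : (Fin n → ℝ) → ℝ) : Prop :=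
  π = (volume.restrict (cube n)).withDensity fun v => ENNReal.ofReal (f v)

/-- `f` is symmetric in its arguments on the cube. -/
def IsSymmetricDensity (f : (Fin n → ℝ) → ℝ) : Prop :=
  ∀ σ : Equiv.Perm (Fin n), ∀ v ∈ cube n, f (fun i => v (σ i)) = f v

/-- The conditional marginal density `f_i(x | v_{-i})`; it does not depend on the coordinate `v i`. -/
def condDensity (f : (Fin n → ℝ) → ℝ) (i : Fin n) (v : Fin n → ℝ) (x : ℝ) : ℝ :=
  f (Function.update v i x) / ∫ t in (0 : ℝ)..1, f (Function.update v i t)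

/-- The conditional cumulative distribution function `F_i(x | v_{-i})`, for `0 ≤ x ≤ 1`. -/
def condCDF (f : (Fin n → ℝ) → ℝ) (i : Fin n) (v : Fin n → ℝ) (x : ℝ) : ℝ :=
  ∫ t in (0 : ℝ)..x, condDensity f i v t

/-- The conditional revenue curve `B_i(x | v_{-i})`. -/
def condRevenueCurve (f : (Fin n → ℝ) → ℝ) (i : Fin n) (v : Fin n → ℝ) (x : ℝ) : ℝ :=
  x * ∫ t in x..(1 : ℝ), condDensity f i v t

/-- The conditional virtual value `φ_i(x | v_{-i})`. The derivative is taken within `[0,1]`, hence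
is one-sided at the endpoints; it exists whenever the density is continuous on the cube. -/
def condVirtualValue (f : (Fin n → ℝ) → ℝ) (i : Fin n) (v : Fin n → ℝ) (x : ℝ) : ℝ :=
  -(derivWithin (condRevenueCurve f i v) (Icc 0 1) x) / condDensity f i v x

/-- Regularity: all conditional virtual values are non-decreasing. -/
def IsRegular (f : (Fin n → ℝ) → ℝ) : Prop :=
  ∀ i : Fin n, ∀ v ∈ cube n, MonotoneOn (condVirtualValue f i v) (Icc 0 1)

/-- Monotone hazard rate: all conditional inverse hazard rates are non-increasing. -/
def HasMHR (f : (Fin n → ℝ) → ℝ) : Prop :=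
  ∀ i : Fin n, ∀ v ∈ cube n,
    AntitoneOn (fun x => (1 - condCDF f i v x) / condDensity f i v x) (Icc 0 1)

/-- Affiliation (`⊓`, `⊔` are the componentwise minimum and maximum). -/
def IsAffiliated (f : (Fin n → ℝ) → ℝ) : Prop :=
  ∀ v ∈ cube n, ∀ w ∈ cube n, f v * f w ≤ f (v ⊓ w) * f (v ⊔ w)

end Posted

end

namespace Posted

/-! Correlation lets an auction read a price for one buyer off the report of another, which posted
prices cannot do. The density makes all valuations nearly equal, up to `1 / N`, while the common
value `x` has a tail of equal-revenue type, with weight about `(1 + N x)⁻²`.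

Integrating out the other buyers as Gaussians shows that any single price earns at most a constant
times `N⁻²`, up to a common factor `N⁻ᵐ` with `m = n - 1` and the normalization
(`mul_lintegral_kernel_le`). A sequential mechanism is dominated by boundedly many single offers,
one for each possible history and buyer, so it gains only a factor depending on `n`
(`SequentialPostedPrice.revenue_le`). Offering one buyer the valuation reported by another instead
earns about `∫ x (N x)⁻² dx`, which is larger by a factor `log N` (`le_lintegral_mul_kernel`). A
large `N` thus defeats any `α`, for all `k` at once.

The shape conditions rest on the Gaussian penalty. The inverse-square factor is log-convex in each
coordinate, but the penalty, at the same scale `N`, outweighs this as soon as `n ≥ 2`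
(`kernel_update_mul_le`). Coordinatewise log-concavity gives the monotone hazard rate, hence
regularity. Affiliation holds because both factors are log-supermodular on the cube. -/

/-- The sum of the squared differences over all ordered pairs of coordinates. -/
def spread {n : ℕ} (v : Fin n → ℝ) : ℝ := ∑ i, ∑ j, (v i - v j) ^ 2

/-- The unnormalized density: close to equal-revenue along the diagonal, at scale `1 / N`, with a
Gaussian penalty on the differences of the valuations. -/
noncomputable def kernel {n : ℕ} (N : ℝ) (v : Fin n → ℝ) : ℝ :=
  ((1 + N * ∑ i, |v i|) ^ 2)⁻¹ * Real.exp (-(N ^ 2 * spread v))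

/-! ### Symmetry, affiliation and coordinatewise log-concavity of the kernel. -/

section Kernel

variable {n : ℕ} {N : ℝ}

/-- The absolute values keep the kernel positive and continuous on the whole space and not only on
the cube, which the hazard rate arguments below assume. -/
lemma one_le_one_add_mul_sum_abs (hN : 0 ≤ N) (v : Fin n → ℝ) : 1 ≤ 1 + N * ∑ i, |v i| := by
  have : 0 ≤ ∑ i, |v i| := Finset.sum_nonneg fun i _ => abs_nonneg _
  nlinarith [mul_nonneg hN this]

lemma kernel_pos (hN : 0 ≤ N) (v : Fin n → ℝ) : 0 < kernel N v := by
  have := one_le_one_add_mul_sum_abs hN v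
  unfold kernel
  positivity

lemma continuous_kernel (hN : 0 ≤ N) : Continuous (kernel (n := n) N) := by
  unfold kernel spread
  refine Continuous.mul (Continuous.inv₀ (by fun_prop) fun v => ?_) (by fun_prop)
  have := one_le_one_add_mul_sum_abs hN v
  positivity

lemma kernel_mul_kernel (v w : Fin n → ℝ) : kernel N v * kernel N w =
    (((1 + N * ∑ i, |v i|) * (1 + N * ∑ i, |w i|)) ^ 2)⁻¹ *
      Real.exp (-(N ^ 2 * (spread v + spread w))) := by
  rw [kernel, kernel, mul_mul_mul_comm, ← Real.exp_add, ← mul_inv, ← mul_pow]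
  congr 2
  ring

lemma kernel_comp_perm (σ : Equiv.Perm (Fin n)) (v : Fin n → ℝ) :
    kernel N (fun i => v (σ i)) = kernel N v := by
  unfold kernel spread
  rw [Equiv.sum_comp σ fun i => |v i|, ← Equiv.sum_comp σ fun i => ∑ j, (v i - v j) ^ 2]
  congr 4
  refine Finset.sum_congr rfl fun i _ => ?_
  rw [← Equiv.sum_comp σ fun j => (v (σ i) - v j) ^ 2]

/-- If the two pairs are ordered alike, both sides agree; otherwise sorting them lowers the sum by
twice the product of the gaps `|a - c|` and `|b - d|`. -/
lemma sq_min_sub_add_sq_max_sub_le (a b c d : ℝ) :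
    (min a c - min b d) ^ 2 + (max a c - max b d) ^ 2 ≤ (a - b) ^ 2 + (c - d) ^ 2 := by
  rcases le_total a c with h | h <;> rcases le_total b d with h' | h' <;>
    simp only [h, h', min_eq_left, min_eq_right, max_eq_left, max_eq_right] <;>
    nlinarith [mul_nonneg (sub_nonneg.2 h) (sub_nonneg.2 h')]

lemma spread_inf_add_spread_sup_le (v w : Fin n → ℝ) :
    spread (v ⊓ w) + spread (v ⊔ w) ≤ spread v + spread w := by
  simp only [spread, ← Finset.sum_add_distrib]
  exact Finset.sum_le_sum fun i _ => Finset.sum_le_sum fun j _ =>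
    sq_min_sub_add_sq_max_sub_le _ _ _ _

lemma sum_abs_of_mem_cube {v : Fin n → ℝ} (hv : v ∈ cube n) : ∑ i, |v i| = ∑ i, v i :=
  Finset.sum_congr rfl fun i _ => abs_of_nonneg (hv.1 i)

/-- Passing to infimum and supremum preserves the total of the two coordinate sums and moves them
apart. The product of the linear factors therefore drops and its inverse square grows; submodularity
of `spread` handles the exponential. -/
lemma kernel_mul_le_kernel_inf_mul_sup (hN : 0 ≤ N) {v w : Fin n → ℝ} (hv : v ∈ cube n)
    (hw : w ∈ cube n) : kernel N v * kernel N w ≤ kernel N (v ⊓ w) * kernel N (v ⊔ w) := by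
  have hi : v ⊓ w ∈ cube n := ⟨le_inf hv.1 hw.1, inf_le_left.trans hv.2⟩
  have hs : v ⊔ w ∈ cube n := ⟨hv.1.trans le_sup_left, sup_le hv.2 hw.2⟩
  have hv1 := one_le_one_add_mul_sum_abs hN v
  have hw1 := one_le_one_add_mul_sum_abs hN w
  have hi1 := one_le_one_add_mul_sum_abs hN (v ⊓ w)
  have hs1 := one_le_one_add_mul_sum_abs hN (v ⊔ w)
  have hsum : ∑ i, (v ⊓ w) i + ∑ i, (v ⊔ w) i = ∑ i, v i + ∑ i, w i := by
    simp only [← Finset.sum_add_distrib]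
    exact Finset.sum_congr rfl fun i _ => min_add_max _ _
  have hiv : ∑ i, (v ⊓ w) i ≤ ∑ i, v i := Finset.sum_le_sum fun i _ => min_le_left _ _
  have hiw : ∑ i, (v ⊓ w) i ≤ ∑ i, w i := Finset.sum_le_sum fun i _ => min_le_right _ _
  have hQ := spread_inf_add_spread_sup_le v w
  rw [kernel_mul_kernel, kernel_mul_kernel]
  rw [sum_abs_of_mem_cube hv] at hv1 ⊢
  rw [sum_abs_of_mem_cube hw] at hw1 ⊢
  rw [sum_abs_of_mem_cube hi] at hi1 ⊢
  rw [sum_abs_of_mem_cube hs] at hs1 ⊢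
  have hprod : (1 + N * ∑ i, (v ⊓ w) i) * (1 + N * ∑ i, (v ⊔ w) i) ≤
      (1 + N * ∑ i, v i) * (1 + N * ∑ i, w i) := by
    have : ∑ i, (v ⊔ w) i = ∑ i, v i + ∑ i, w i - ∑ i, (v ⊓ w) i := by linarith
    rw [this]
    nlinarith [mul_nonneg (mul_nonneg hN hN) (mul_nonneg (sub_nonneg.2 hiv) (sub_nonneg.2 hiw))]
  gcongr

lemma spread_eq (v : Fin n → ℝ) :
    spread v = 2 * n * ∑ i, v i ^ 2 - 2 * (∑ i, v i) ^ 2 := by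
  simp only [spread, sub_sq, Finset.sum_add_distrib, Finset.sum_sub_distrib, Finset.sum_const,
    Finset.card_univ, Fintype.card_fin, ← Finset.mul_sum, ← Finset.sum_mul, nsmul_eq_mul]
  ring

lemma sum_apply_update (φ : ℝ → ℝ) (v : Fin n → ℝ) (i : Fin n) (t : ℝ) :
    ∑ j, φ (Function.update v i t j) = φ t + ∑ j ∈ Finset.univ.erase i, φ (v j) := by
  rw [← Finset.add_sum_erase _ _ (Finset.mem_univ i), Function.update_self]
  congr 1
  exact Finset.sum_congr rfl fun j hj => by rw [Function.update_of_ne (Finset.ne_of_mem_erase hj)]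

/-- Only the leading coefficient matters later: it is the curvature that pays for the log-convex
factor. -/
lemma spread_update (v : Fin n → ℝ) (i : Fin n) :
    ∃ a b : ℝ, ∀ t, spread (Function.update v i t) = a + b * t + 2 * (n - 1) * t ^ 2 := by
  refine ⟨2 * n * ∑ j ∈ Finset.univ.erase i, v j ^ 2 - 2 * (∑ j ∈ Finset.univ.erase i, v j) ^ 2,
    -4 * ∑ j ∈ Finset.univ.erase i, v j, fun t => ?_⟩
  have h1 := sum_apply_update (fun x => x) v i t
  have h2 := sum_apply_update (fun x => x ^ 2) v i t
  rw [spread_eq, h1, h2]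
  ring

lemma update_mem_cube {v : Fin n → ℝ} (hv : v ∈ cube n) (i : Fin n) {t : ℝ}
    (ht : t ∈ Icc (0 : ℝ) 1) : Function.update v i t ∈ cube n := by
  constructor <;> intro j <;> rcases eq_or_ne j i with rfl | h
  · simpa using ht.1
  · simpa [h] using hv.1 j
  · simpa using ht.2
  · simpa [h] using hv.2 j

/-- Log-concavity of the kernel in each coordinate, in four-point form. -/
lemma kernel_update_mul_le (hn : 2 ≤ n) (hN : 0 ≤ N) {v : Fin n → ℝ} (hv : v ∈ cube n) (i : Fin n)
    {x s d : ℝ} (hx : 0 ≤ x) (hd : 0 ≤ d) (hxs : x + d ≤ s) (hs : s ≤ 1) :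
    kernel N (Function.update v i s) * kernel N (Function.update v i x) ≤
      kernel N (Function.update v i (s - d)) * kernel N (Function.update v i (x + d)) := by
  obtain ⟨a, b, hab⟩ := spread_update v i
  set c := ∑ j ∈ Finset.univ.erase i, v j with hc
  have hc0 : 0 ≤ c := Finset.sum_nonneg fun j _ => hv.1 j
  have hsum : ∀ t ∈ Icc (0 : ℝ) 1, ∑ j, |Function.update v i t j| = t + c := fun t ht => by
    rw [sum_abs_of_mem_cube (update_mem_cube hv i ht)]
    exact sum_apply_update (fun x => x) v i t
  rw [kernel_mul_kernel, kernel_mul_kernel]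
  rw [hsum s ⟨by linarith, hs⟩, hsum x ⟨hx, by linarith⟩, hsum (s - d) ⟨by linarith, by linarith⟩,
    hsum (x + d) ⟨by linarith, by linarith⟩]
  simp only [hab]
  -- Moving both points inward by `d` raises the product of the linear factors by exactly `e` and
  -- the exponent by `4 (n - 1) e`. As `P ≥ 1`, the inverse square loses at most a factor `exp (2
  -- e)`, and `2 ≤ 4 (n - 1)`.
  set e := N ^ 2 * (d * (s - d - x)) with he
  have he0 : 0 ≤ e := mul_nonneg (sq_nonneg N) (mul_nonneg hd (by linarith))
  set P := (1 + N * (s + c)) * (1 + N * (x + c)) with hP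
  have hP1 : 1 ≤ P := by
    have h1 : 0 ≤ N * (s + c) := mul_nonneg hN (by linarith)
    have h2 : 0 ≤ N * (x + c) := mul_nonneg hN (by linarith)
    nlinarith [mul_nonneg h1 h2]
  have hPe : (1 + N * (s - d + c)) * (1 + N * (x + d + c)) = P + e := by
    rw [hP, he]; ring
  have hn' : (2 : ℝ) ≤ n := by exact_mod_cast hn
  have hexp : -(N ^ 2 * (a + b * (s - d) + 2 * (n - 1) * (s - d) ^ 2 +
      (a + b * (x + d) + 2 * (n - 1) * (x + d) ^ 2))) =
      -(N ^ 2 * (a + b * s + 2 * (n - 1) * s ^ 2 +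
      (a + b * x + 2 * (n - 1) * x ^ 2))) + 4 * (n - 1) * e := by
    rw [he]; ring
  rw [hPe, hexp, Real.exp_add _ (4 * (n - 1) * e), mul_comm (Real.exp _) (Real.exp (4 * _ * e)),
    ← mul_assoc]
  refine mul_le_mul_of_nonneg_right ?_ (Real.exp_pos _).le
  rw [inv_le_iff_one_le_mul₀ (by positivity), mul_comm, ← mul_assoc, ← div_eq_mul_inv, ← mul_div_right_comm,
    le_div_iff₀ (by positivity), one_mul]
  have h1 : P + e ≤ P * Real.exp e := by
    nlinarith [Real.add_one_le_exp e, mul_le_mul_of_nonneg_left (Real.add_one_le_exp e) (by linarith : 0 ≤ P)]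
  calc (P + e) ^ 2 ≤ (P * Real.exp e) ^ 2 := by gcongr
    _ = P ^ 2 * Real.exp (2 * e) := by rw [mul_pow, ← Real.exp_nat_mul]; norm_num
    _ ≤ P ^ 2 * Real.exp (4 * (n - 1) * e) := by
        gcongr
        nlinarith

end Kernel

/-! ### Monotone hazard rate and regularity from log-concavity. -/

section Hazard

/-- The four-point inequality compares the tail from `y` with its translate by `y - x`, which covers
only a part of the tail from `x`. -/
lemma antitoneOn_tailIntegral_div {g : ℝ → ℝ} (hg : Continuous g) (hpos : ∀ x, 0 < g x)
    (h4 : ∀ x s d, 0 ≤ x → 0 ≤ d → x + d ≤ s → s ≤ 1 → g s * g x ≤ g (s - d) * g (x + d)) :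
    AntitoneOn (fun x => (∫ t in x..(1 : ℝ), g t) / g x) (Icc 0 1) := by
  intro x hx y hy hxy
  have hint : ∀ a b : ℝ, IntervalIntegrable g volume a b := fun a b => hg.intervalIntegrable a b
  simp only
  rw [div_le_div_iff₀ (hpos y) (hpos x)]
  calc (∫ t in y..(1 : ℝ), g t) * g x = ∫ t in y..(1 : ℝ), g t * g x :=
        (intervalIntegral.integral_mul_const _ _).symm
    _ ≤ ∫ t in y..(1 : ℝ), g (t - (y - x)) * g y := by
        refine intervalIntegral.integral_mono_on hy.2
          (Continuous.intervalIntegrable (by fun_prop) _ _)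
          (Continuous.intervalIntegrable (by fun_prop) _ _) fun t ht => ?_
        have := h4 x t (y - x) hx.1 (sub_nonneg.2 hxy) (by linarith [ht.1]) ht.2
        rwa [add_sub_cancel] at this
    _ = (∫ t in x..(1 - (y - x)), g t) * g y := by
        rw [intervalIntegral.integral_mul_const, intervalIntegral.integral_comp_sub_right,
          sub_sub_cancel]
    _ ≤ (∫ t in x..(1 : ℝ), g t) * g y := by
        refine mul_le_mul_of_nonneg_right ?_ (hpos y).le
        rw [← intervalIntegral.integral_add_adjacent_intervals (hint x (1 - (y - x))) (hint _ 1)]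
        exact le_add_of_nonneg_right
          (intervalIntegral.integral_nonneg (by linarith) fun t _ => (hpos t).le)

variable {n : ℕ} {f : (Fin n → ℝ) → ℝ} (hf : Continuous f) (hpos : ∀ v, 0 < f v)

include hf

lemma continuous_condDensity (i : Fin n) (v : Fin n → ℝ) : Continuous (condDensity f i v) :=
  (hf.comp (by fun_prop)).div_const _

include hpos

lemma integral_update_pos (i : Fin n) (v : Fin n → ℝ) :
    0 < ∫ t in (0 : ℝ)..1, f (Function.update v i t) :=
  intervalIntegral.intervalIntegral_pos_of_pos
    ((hf.comp (by fun_prop)).intervalIntegrable _ _) (fun t => hpos _) one_pos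

lemma condDensity_pos (i : Fin n) (v : Fin n → ℝ) (x : ℝ) : 0 < condDensity f i v x :=
  div_pos (hpos _) (integral_update_pos hf hpos i v)

lemma integral_condDensity (i : Fin n) (v : Fin n → ℝ) :
    ∫ t in (0 : ℝ)..1, condDensity f i v t = 1 := by
  unfold condDensity
  rw [intervalIntegral.integral_div, div_self (integral_update_pos hf hpos i v).ne']

lemma one_sub_condCDF (i : Fin n) (v : Fin n → ℝ) (x : ℝ) :
    1 - condCDF f i v x = ∫ t in x..(1 : ℝ), condDensity f i v t := by
  have hc := continuous_condDensity hf i v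
  rw [condCDF, sub_eq_iff_eq_add', intervalIntegral.integral_add_adjacent_intervals
    (hc.intervalIntegrable _ _) (hc.intervalIntegrable _ _), integral_condDensity hf hpos]

/-- Writing the virtual value as `x` minus the inverse hazard rate reduces regularity to the
monotone hazard rate. -/
lemma condVirtualValue_eq (i : Fin n) (v : Fin n → ℝ) {x : ℝ} (hx : x ∈ Icc (0 : ℝ) 1) :
    condVirtualValue f i v x =
      x - (∫ t in x..(1 : ℝ), condDensity f i v t) / condDensity f i v x := by
  have hc := continuous_condDensity hf i v
  have h1 : HasDerivAt (fun y => ∫ t in y..(1 : ℝ), condDensity f i v t)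
      (-condDensity f i v x) x :=
    intervalIntegral.integral_hasDerivAt_left (hc.intervalIntegrable _ _)
      hc.aestronglyMeasurable.stronglyMeasurableAtFilter hc.continuousAt
  have h2 : HasDerivAt (condRevenueCurve f i v)
      (1 * (∫ t in x..(1 : ℝ), condDensity f i v t) + x * -condDensity f i v x) x :=
    (hasDerivAt_id x).mul h1
  rw [condVirtualValue, h2.hasDerivWithinAt.derivWithin (uniqueDiffOn_Icc one_pos x hx)]
  have := (condDensity_pos hf hpos i v x).ne'
  field_simp
  ring

variable (h4 : ∀ i, ∀ v ∈ cube n, ∀ x s d : ℝ, 0 ≤ x → 0 ≤ d → x + d ≤ s → s ≤ 1 →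
  f (Function.update v i s) * f (Function.update v i x) ≤
    f (Function.update v i (s - d)) * f (Function.update v i (x + d)))

include h4

lemma antitoneOn_inverse_hazard (i : Fin n) {v : Fin n → ℝ} (hv : v ∈ cube n) :
    AntitoneOn (fun x => (∫ t in x..(1 : ℝ), condDensity f i v t) / condDensity f i v x)
      (Icc 0 1) := by
  refine antitoneOn_tailIntegral_div (continuous_condDensity hf i v)
    (condDensity_pos hf hpos i v) fun x s d hx hd hxs hs => ?_
  simp only [condDensity, div_mul_div_comm]
  exact div_le_div_of_nonneg_right (h4 i v hv x s d hx hd hxs hs) (mul_self_nonneg _)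

lemma hasMHR_of_logConcave : HasMHR f := fun i v hv => by
  simp only [one_sub_condCDF hf hpos]
  exact antitoneOn_inverse_hazard hf hpos h4 i hv

lemma isRegular_of_logConcave : IsRegular f := fun i v hv x hx y hy hxy => by
  rw [condVirtualValue_eq hf hpos i v hx, condVirtualValue_eq hf hpos i v hy]
  exact sub_le_sub hxy (antitoneOn_inverse_hazard hf hpos h4 i hv hx hy hxy)

end Hazard

/-! ### Upper bound for sequential posted prices by single offers. -/

namespace SequentialPostedPrice

variable {n : ℕ} (M : SequentialPostedPrice n)

lemma length_history (ω : M.Ω) (v : Fin n → ℝ) (t : ℕ) : (M.history ω v t).length = t := by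
  induction t with
  | zero => rfl
  | succ t ih => simp [history, ih]

open scoped Classical in
/-- The revenue of a run is at most the total over all conceivable histories `h` and all buyers `i`
of the revenue from offering buyer `i` the price posted after `h`. -/
lemma ofReal_runRevenue_le (k : ℕ) (ω : M.Ω) (v : Fin n → ℝ) :
    ENNReal.ofReal (M.runRevenue k ω v) ≤
      ∑ t ∈ Finset.range n, ∑ b : Fin t → Bool, ∑ i : Fin n,
        {q : (Fin n → ℝ) × M.Ω | M.price q.2 (List.ofFn b) ≤ q.1 i}.indicator
          (fun q => ENNReal.ofReal (M.price q.2 (List.ofFn b))) (v, ω) := by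
  unfold runRevenue
  rw [ENNReal.ofReal_sum_of_nonneg fun t _ => by split_ifs <;> simp [M.price_nonneg]]
  refine Finset.sum_le_sum fun t _ => ?_
  obtain ⟨b, hb⟩ : ∃ b : Fin t → Bool, List.ofFn b = M.history ω v t := by
    have h := M.length_history ω v t
    refine ⟨fun j => (M.history ω v t).get (j.cast h.symm), ?_⟩
    rw [List.ofFn_congr h.symm]
    simp
  refine le_trans ?_ (Finset.single_le_sum (fun _ _ => zero_le) (Finset.mem_univ b))
  refine le_trans ?_ (Finset.single_le_sum (fun _ _ => zero_le)
    (Finset.mem_univ (M.buyer ω (M.history ω v t))))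
  rw [hb]
  split_ifs with h
  · rw [indicator_of_mem (by exact h.2)]
  · simp

/-- Once the seed is fixed, the price after a given history is a constant, so every summand is the
revenue of one fixed offer; hence the exchange of integrals. Summing over all histories and buyers
removes adaptivity at the cost of a factor depending only on `n`. -/
lemma revenue_le (π : Measure (Fin n → ℝ)) [SFinite π] (k : ℕ) {r : ℝ≥0∞}
    (hr : ∀ i, ∀ p : ℝ, 0 ≤ p → ENNReal.ofReal p * π {v | p ≤ v i} ≤ r) :
    M.revenue π k ≤ (∑ t ∈ Finset.range n, 2 ^ t * n : ℕ) * r := by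
  classical
  have hmeas : ∀ (h : List Bool) (i : Fin n), Measurable
      ({q : (Fin n → ℝ) × M.Ω | M.price q.2 h ≤ q.1 i}.indicator
          fun q => ENNReal.ofReal (M.price q.2 h)) := fun h i => by
    have hp : Measurable fun q : (Fin n → ℝ) × M.Ω => M.price q.2 h :=
      (M.measurable_price h).comp measurable_snd
    exact hp.ennreal_ofReal.indicator (measurableSet_le hp (by fun_prop))
  calc M.revenue π k
      ≤ ∫⁻ v, ∫⁻ ω, ∑ t ∈ Finset.range n, ∑ b : Fin t → Bool, ∑ i : Fin n,
        {q : (Fin n → ℝ) × M.Ω | M.price q.2 (List.ofFn b) ≤ q.1 i}.indicator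
          (fun q => ENNReal.ofReal (M.price q.2 (List.ofFn b))) (v, ω) ∂M.P ∂π :=
        lintegral_mono fun v => lintegral_mono fun ω => M.ofReal_runRevenue_le k ω v
    _ = ∫⁻ ω, ∫⁻ v, ∑ t ∈ Finset.range n, ∑ b : Fin t → Bool, ∑ i : Fin n,
        {q : (Fin n → ℝ) × M.Ω | M.price q.2 (List.ofFn b) ≤ q.1 i}.indicator
          (fun q => ENNReal.ofReal (M.price q.2 (List.ofFn b))) (v, ω) ∂π ∂M.P :=
        lintegral_lintegral_swap (Measurable.aemeasurable
          (Finset.measurable_fun_sum _ fun t _ => Finset.measurable_fun_sum _ fun b _ =>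
            Finset.measurable_fun_sum _ fun i _ => hmeas _ i))
    _ ≤ ∫⁻ ω, (∑ t ∈ Finset.range n, 2 ^ t * n : ℕ) * r ∂M.P := by
        refine lintegral_mono fun ω => ?_
        have hm : ∀ (h : List Bool) (i : Fin n), Measurable fun v : Fin n → ℝ =>
            {q : (Fin n → ℝ) × M.Ω | M.price q.2 h ≤ q.1 i}.indicator
              (fun q => ENNReal.ofReal (M.price q.2 h)) (v, ω) :=
          fun h i => (hmeas h i).comp measurable_prodMk_right
        rw [lintegral_finsetSum _ fun t _ => Finset.measurable_fun_sum _ fun b _ =>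
            Finset.measurable_fun_sum _ fun i _ => hm _ i, Nat.cast_sum, Finset.sum_mul]
        refine Finset.sum_le_sum fun t _ => ?_
        rw [lintegral_finsetSum _ fun b _ => Finset.measurable_fun_sum _ fun i _ => hm _ i]
        have hterm : ∀ (h : List Bool) (i : Fin n), ∫⁻ v,
            {q : (Fin n → ℝ) × M.Ω | M.price q.2 h ≤ q.1 i}.indicator
              (fun q => ENNReal.ofReal (M.price q.2 h)) (v, ω) ∂π ≤ r := fun h i => by
          refine le_trans (le_of_eq ?_) (hr i _ (M.price_nonneg ω h))
          rw [← lintegral_indicator_const (measurableSet_le measurable_const (by fun_prop))]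
          rfl
        calc ∑ b : Fin t → Bool, ∫⁻ v, ∑ i : Fin n,
              {q : (Fin n → ℝ) × M.Ω | M.price q.2 (List.ofFn b) ≤ q.1 i}.indicator
                (fun q => ENNReal.ofReal (M.price q.2 (List.ofFn b))) (v, ω) ∂π
            ≤ ∑ _b : Fin t → Bool, ∑ _i : Fin n, r := by
              refine Finset.sum_le_sum fun b _ => ?_
              rw [lintegral_finsetSum _ fun i _ => hm _ i]
              exact Finset.sum_le_sum fun i _ => hterm _ i
          _ = ((2 ^ t * n : ℕ) : ℝ≥0∞) * r := by
              simp [mul_assoc]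
    _ = (∑ t ∈ Finset.range n, 2 ^ t * n : ℕ) * r := by simp

end SequentialPostedPrice

/-! ### Lower bound for the optimum by pricing from another report. -/

/-- The mechanism that offers buyer `i` one unit at the price reported by buyer `j`. -/
noncomputable def priceFromReport {n k : ℕ} (hk : 1 ≤ k) (i j : Fin n) : DirectMechanism n k where
  Ω := Unit
  P := Measure.dirac ()
  -- Truncating at `0` keeps payments nonnegative at arbitrary, possibly negative, reports.
  alloc _ s l := if l = i ∧ max (s j) 0 ≤ s i then 1 else 0
  pay _ s l := if l = i ∧ max (s j) 0 ≤ s i then max (s j) 0 else 0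
  alloc_zero_or_one _ s l := by split_ifs <;> simp
  alloc_le _ s := by
    have h1 : ∀ l, (if l = i ∧ max (s j) 0 ≤ s i then (1 : ℝ) else 0) ≤ if l = i then 1 else 0 :=
      fun l => by split_ifs <;> simp_all
    refine (Finset.sum_le_sum fun l _ => h1 l).trans ?_
    simpa using hk
  pay_nonneg _ s l := by split_ifs <;> simp
  measurable_alloc l := by
    by_cases h : l = i
    · simp only [h, true_and]
      exact Measurable.ite (measurableSet_le (by fun_prop) (by fun_prop)) measurable_const
        measurable_const
    · simp [h]
  measurable_pay l := by
    by_cases h : l = i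
    · simp only [h, true_and]
      exact Measurable.ite (measurableSet_le (by fun_prop) (by fun_prop)) (by fun_prop)
        measurable_const
    · simp [h]
  integrable_pay s l := integrable_const _

section PriceFromReport

variable {n k : ℕ} (hk : 1 ≤ k) {i j : Fin n}

lemma priceFromReport_expAlloc (s : Fin n → ℝ) (l : Fin n) :
    (priceFromReport hk i j).expAlloc s l = if l = i ∧ max (s j) 0 ≤ s i then 1 else 0 :=
  integral_dirac (fun _ => _) ()

lemma priceFromReport_expPay (s : Fin n → ℝ) (l : Fin n) :
    (priceFromReport hk i j).expPay s l =
      if l = i ∧ max (s j) 0 ≤ s i then max (s j) 0 else 0 :=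
  integral_dirac (fun _ => _) ()

/-- Since `i ≠ j`, the price offered to buyer `i` does not depend on his own report. -/
lemma priceFromReport_isDSIC (hij : i ≠ j) (π : Measure (Fin n → ℝ)) :
    (priceFromReport hk i j).IsDSIC π := by
  intro l s v _ _
  simp only [priceFromReport_expAlloc, priceFromReport_expPay]
  by_cases hl : l = i
  · subst hl
    simp only [true_and, Function.update_self, Function.update_of_ne hij.symm]
    split_ifs <;> linarith
  · simp [hl]

lemma priceFromReport_isExPostIR (π : Measure (Fin n → ℝ)) :
    (priceFromReport hk i j).IsExPostIR π := by
  intro l v _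
  simp only [priceFromReport_expAlloc, priceFromReport_expPay]
  split_ifs with h
  · obtain ⟨rfl, h⟩ := h
    linarith
  · simp

include hk in
lemma lintegral_price_le_optimalRevenue (hij : i ≠ j) (π : Measure (Fin n → ℝ)) :
    ∫⁻ v in {v | v j ≤ v i ∧ 0 ≤ v j}, ENNReal.ofReal (v j) ∂π ≤ optimalRevenue π k := by
  refine le_trans ?_ (le_iSup₂_of_le (priceFromReport hk i j) (priceFromReport_isDSIC hk hij π)
    (le_iSup_of_le (priceFromReport_isExPostIR hk π) le_rfl))
  have hm : MeasurableSet {v : Fin n → ℝ | v j ≤ v i ∧ 0 ≤ v j} :=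
    (measurableSet_le (measurable_pi_apply j) (measurable_pi_apply i)).inter
      (measurableSet_le measurable_const (measurable_pi_apply j))
  rw [← lintegral_indicator hm]
  refine lintegral_mono (indicator_le fun v hv => ?_)
  simp [priceFromReport_expPay, max_eq_left hv.2, hv.1]

end PriceFromReport

/-! ### Integral estimates for the unnormalized kernel. -/

section Estimates

variable {m : ℕ} {N : ℝ}

lemma lintegral_eq_lintegral_insertNth (i : Fin (m + 1)) {F : (Fin (m + 1) → ℝ) → ℝ≥0∞}
    (hF : Measurable F) :
    ∫⁻ v, F v = ∫⁻ x : ℝ, ∫⁻ w : Fin m → ℝ, F (i.insertNth x w) := by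
  have h := (volume_preserving_piFinSuccAbove (fun _ : Fin (m + 1) => ℝ) i).symm
  rw [← h.lintegral_comp hF]
  exact lintegral_prod _ (hF.comp h.measurable).aemeasurable

lemma sum_sq_sub_le_spread {n : ℕ} (v : Fin n → ℝ) (i : Fin n) :
    ∑ j, (v i - v j) ^ 2 ≤ spread v :=
  Finset.single_le_sum (f := fun i => ∑ j, (v i - v j) ^ 2)
    (fun _ _ => Finset.sum_nonneg fun _ _ => sq_nonneg _) (Finset.mem_univ i)

/-- Keeping only the terms of the spread that compare with coordinate `i` decouples the others into
Gaussians centred at `x`. -/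
lemma kernel_insertNth_le (hN : 0 ≤ N) (i : Fin (m + 1)) {x : ℝ} (hx : 0 ≤ x) (w : Fin m → ℝ) :
    kernel N (i.insertNth x w : Fin (m + 1) → ℝ) ≤
      ((1 + N * x) ^ 2)⁻¹ * ∏ j, Real.exp (-N ^ 2 * (w j - x) ^ 2) := by
  rw [← Real.exp_sum, ← Finset.mul_sum]
  have h1 : x ≤ ∑ l, |(i.insertNth x w : Fin (m + 1) → ℝ) l| := by
    have := Finset.single_le_sum (f := fun l => |(i.insertNth x w : Fin (m + 1) → ℝ) l|)
      (fun _ _ => abs_nonneg _) (Finset.mem_univ i)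
    exact (le_abs_self x).trans (by simpa using this)
  have h2 : ∑ j, (w j - x) ^ 2 ≤ spread (i.insertNth x w : Fin (m + 1) → ℝ) := by
    refine le_trans (le_of_eq ?_) (sum_sq_sub_le_spread _ i)
    rw [Fin.sum_univ_succAbove _ i]
    simp only [Fin.insertNth_apply_same, Fin.insertNth_apply_succAbove, sub_self]
    rw [zero_pow two_ne_zero, zero_add]
    exact Finset.sum_congr rfl fun j _ => by ring
  unfold kernel
  rw [← neg_mul]
  gcongr ?_ * Real.exp ?_
  · gcongr
  · nlinarith [mul_le_mul_of_nonneg_left h2 (sq_nonneg N)]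

lemma lintegral_prod_gaussian (hN : 0 < N) (x : ℝ) :
    ∫⁻ w : Fin m → ℝ, ENNReal.ofReal (∏ j, Real.exp (-N ^ 2 * (w j - x) ^ 2)) =
      ENNReal.ofReal ((√Real.pi / N) ^ m) := by
  have hint : Integrable fun t : ℝ => Real.exp (-N ^ 2 * (t - x) ^ 2) :=
    (integrable_exp_neg_mul_sq (by positivity : 0 < N ^ 2)).comp_sub_right x
  have hprod : Integrable fun w : Fin m → ℝ => ∏ j, Real.exp (-N ^ 2 * (w j - x) ^ 2) :=
    Integrable.fintype_prod fun _ => hint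
  rw [← ofReal_integral_eq_lintegral_ofReal hprod
    (Filter.Eventually.of_forall fun w => Finset.prod_nonneg fun j _ => (Real.exp_pos _).le),
    integral_fintype_prod_volume_eq_pow fun t : ℝ => Real.exp (-N ^ 2 * (t - x) ^ 2),
    integral_sub_right_eq_self fun t : ℝ => Real.exp (-N ^ 2 * t ^ 2), integral_gaussian,
    Fintype.card_fin, Real.sqrt_div Real.pi_pos.le, Real.sqrt_sq hN.le]

/-- This is the equal-revenue property: the tail beyond `p` is at most `1 / (N (1 + N p))`, and `N p
≤ 1 + N p` makes the product with `p` bounded independently of `p`. -/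
lemma mul_lintegral_inv_sq_le (hN : 0 < N) {p : ℝ} (hp : 0 ≤ p) :
    ENNReal.ofReal p * ∫⁻ x in Icc p 1, ENNReal.ofReal ((1 + N * x) ^ 2)⁻¹ ≤
      ENNReal.ofReal (N ^ 2)⁻¹ := by
  rcases lt_or_ge 1 p with h1 | h1
  · simp [Icc_eq_empty_of_lt h1]
  have hpos : ∀ x ∈ uIcc p 1, 0 < 1 + N * x := fun x hx => by
    rw [uIcc_of_le h1] at hx
    nlinarith [mul_nonneg hN.le (hp.trans hx.1)]
  have hcont : ContinuousOn (fun x : ℝ => ((1 + N * x) ^ 2)⁻¹) (uIcc p 1) :=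
    ContinuousOn.inv₀ (by fun_prop) fun x hx => (pow_pos (hpos x hx) 2).ne'
  have hftc : ∫ x in p..(1 : ℝ), ((1 + N * x) ^ 2)⁻¹ =
      -(N * (1 + N * 1))⁻¹ - -(N * (1 + N * p))⁻¹ := by
    refine intervalIntegral.integral_eq_sub_of_hasDerivAt (f := fun x => -(N * (1 + N * x))⁻¹)
      (fun x hx => ?_) hcont.intervalIntegrable
    have h0 := hpos x hx
    have hd : HasDerivAt (fun x : ℝ => N * (1 + N * x)) (N * (N * 1)) x :=
      (((hasDerivAt_id x).const_mul N).const_add 1).const_mul N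
    refine (hd.fun_inv (by positivity)).neg.congr_deriv ?_
    field_simp
  have hp1 : 0 < 1 + N * p := hpos p left_mem_uIcc
  rw [← ofReal_integral_eq_lintegral_ofReal
    ((uIcc_of_le h1 ▸ hcont).integrableOn_compact isCompact_Icc)
    (Filter.Eventually.of_forall fun x => by positivity),
    integral_Icc_eq_integral_Ioc, ← intervalIntegral.integral_of_le h1, hftc,
    ← ENNReal.ofReal_mul hp]
  refine ENNReal.ofReal_le_ofReal ?_
  have h2 : 0 ≤ (N * (1 + N * 1))⁻¹ := by positivity
  calc p * (-(N * (1 + N * 1))⁻¹ - -(N * (1 + N * p))⁻¹) ≤ p * (N * (1 + N * p))⁻¹ :=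
        mul_le_mul_of_nonneg_left (by linarith) hp
    _ ≤ (N ^ 2)⁻¹ := by
        rw [← div_eq_mul_inv, div_le_iff₀ (by positivity), inv_mul_eq_div, le_div_iff₀ (by positivity)]
        nlinarith

lemma measurableSet_cube {n : ℕ} : MeasurableSet (cube n) := measurableSet_Icc

/-- Posting a price `p` to buyer `i` earns little, uniformly in `p`. -/
lemma mul_lintegral_kernel_le (hN : 0 < N) (i : Fin (m + 1)) {p : ℝ} (hp : 0 ≤ p) :
    ENNReal.ofReal p * ∫⁻ v in {v | p ≤ v i} ∩ cube (m + 1), ENNReal.ofReal (kernel N v) ≤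
      ENNReal.ofReal ((√Real.pi / N) ^ m * (N ^ 2)⁻¹) := by
  have hmeas : MeasurableSet ({v : Fin (m + 1) → ℝ | p ≤ v i} ∩ cube (m + 1)) :=
    (measurableSet_le measurable_const (by fun_prop)).inter measurableSet_cube
  have hk : Measurable fun v : Fin (m + 1) → ℝ => ENNReal.ofReal (kernel N v) :=
    (continuous_kernel hN.le).measurable.ennreal_ofReal
  rw [← lintegral_indicator hmeas, lintegral_eq_lintegral_insertNth i (hk.indicator hmeas)]
  calc ENNReal.ofReal p * ∫⁻ x : ℝ, ∫⁻ w : Fin m → ℝ,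
        ({v : Fin (m + 1) → ℝ | p ≤ v i} ∩ cube (m + 1)).indicator
          (fun v => ENNReal.ofReal (kernel N v)) (i.insertNth x w)
      ≤ ENNReal.ofReal p * ∫⁻ x : ℝ, (Icc p 1).indicator
          (fun x => ENNReal.ofReal ((1 + N * x) ^ 2)⁻¹ *
            ENNReal.ofReal ((√Real.pi / N) ^ m)) x := by
        gcongr with x
        by_cases hx : x ∈ Icc p 1
        · rw [indicator_of_mem hx, ← lintegral_prod_gaussian hN x,
            ← lintegral_const_mul' _ _ ENNReal.ofReal_ne_top]
          refine lintegral_mono fun w => (indicator_le_self _ _ _).trans ?_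
          rw [← ENNReal.ofReal_mul (by positivity)]
          exact ENNReal.ofReal_le_ofReal (kernel_insertNth_le hN.le i (hp.trans hx.1) w)
        · rw [indicator_of_notMem hx, nonpos_iff_eq_zero]
          refine (lintegral_congr fun w => indicator_of_notMem (fun hw => hx ?_) _).trans
            lintegral_zero
          have h1 := hw.1
          have h2 := hw.2.2 i
          simp only [mem_ofPred_eq, Fin.insertNth_apply_same, Pi.one_apply] at h1 h2
          exact ⟨h1, h2⟩
    _ ≤ ENNReal.ofReal ((√Real.pi / N) ^ m * (N ^ 2)⁻¹) := by
        rw [lintegral_indicator measurableSet_Icc, lintegral_mul_const' _ _ ENNReal.ofReal_ne_top,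
          ← mul_assoc, mul_comm ((√Real.pi / N) ^ m), ENNReal.ofReal_mul (by positivity)]
        gcongr
        exact mul_lintegral_inv_sq_le hN hp

/-- Near the diagonal, the second highest valuation times the kernel is of order `1 / v i`. -/
lemma le_mul_kernel (hN : 0 < N) {v : Fin (m + 1) → ℝ} {i : Fin (m + 1)} (hvi : 2 / N ≤ v i)
    (hv : ∀ l, v l ∈ Icc (v i - 1 / N) (v i)) (j : Fin (m + 1)) :
    Real.exp (-(m + 1) ^ 2) / (2 * (m + 2) ^ 2) * (N ^ 2)⁻¹ * (v i)⁻¹ ≤ v j * kernel N v := by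
  set x := v i with hx
  have hNx : 2 ≤ N * x := by rwa [div_le_iff₀' hN] at hvi
  have hx0 : 0 < x := lt_of_lt_of_le (by positivity) hvi
  -- The lower limit `2 / N` makes the width `1 / N` at most half of `x`, so every valuation is
  -- comparable to `x`.
  have h1N : 1 / N ≤ x / 2 := by
    rw [div_le_div_iff₀ hN two_pos]; linarith
  have hvj : x / 2 ≤ v j := by linarith [(hv j).1]
  have hsum : ∑ l, |v l| ≤ (m + 1) * x := by
    calc ∑ l, |v l| ≤ ∑ _l : Fin (m + 1), x := Finset.sum_le_sum fun l _ => by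
          rw [abs_of_nonneg (by linarith [(hv l).1])]
          exact (hv l).2
      _ = (m + 1) * x := by simp
  have hspread : N ^ 2 * spread v ≤ ((m : ℝ) + 1) ^ 2 := by
    have h : spread v ≤ ∑ _i : Fin (m + 1), ∑ _j : Fin (m + 1), (1 / N) ^ 2 :=
      Finset.sum_le_sum fun a _ => Finset.sum_le_sum fun b _ => by
        rw [sq_le_sq, abs_of_nonneg (by positivity : 0 ≤ 1 / N), abs_le]
        constructor <;> linarith [(hv a).1, (hv a).2, (hv b).1, (hv b).2]
    calc N ^ 2 * spread v ≤ N ^ 2 * ∑ _i : Fin (m + 1), ∑ _j : Fin (m + 1), (1 / N) ^ 2 := by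
          gcongr
      _ = ((m : ℝ) + 1) ^ 2 := by
          simp
          field_simp
  have hker : (((m + 2) * (N * x)) ^ 2)⁻¹ * Real.exp (-(m + 1) ^ 2) ≤ kernel N v := by
    unfold kernel
    have h0 := one_le_one_add_mul_sum_abs hN.le v
    have h1 : 1 + N * ∑ l, |v l| ≤ (m + 2) * (N * x) := by
      nlinarith [mul_le_mul_of_nonneg_left hsum hN.le]
    gcongr
  calc Real.exp (-(m + 1) ^ 2) / (2 * (m + 2) ^ 2) * (N ^ 2)⁻¹ * x⁻¹
      = x / 2 * ((((m + 2) * (N * x)) ^ 2)⁻¹ * Real.exp (-(m + 1) ^ 2)) := by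
        field_simp
    _ ≤ v j * kernel N v :=
        mul_le_mul hvj hker (by positivity) ((half_pos hx0).le.trans hvj)

lemma lintegral_inv_Icc {a : ℝ} (ha : 0 < a) (ha1 : a ≤ 1) :
    ∫⁻ x in Icc a 1, ENNReal.ofReal x⁻¹ = ENNReal.ofReal (-Real.log a) := by
  have hcont : ContinuousOn (fun x : ℝ => x⁻¹) (Icc a 1) :=
    ContinuousOn.inv₀ (by fun_prop) fun x hx => (ha.trans_le hx.1).ne'
  rw [← ofReal_integral_eq_lintegral_ofReal (hcont.integrableOn_compact isCompact_Icc),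
    integral_Icc_eq_integral_Ioc, ← intervalIntegral.integral_of_le ha1,
    integral_inv_of_pos ha one_pos, one_div, Real.log_inv]
  filter_upwards [ae_restrict_mem measurableSet_Icc] with x hx
  exact inv_nonneg.2 (ha.le.trans hx.1)

/-- Offering buyer `i` the valuation of buyer `j` as a price earns a lot. -/
lemma le_lintegral_mul_kernel (hN : 2 ≤ N) (i j : Fin (m + 1)) :
    ENNReal.ofReal ((1 / N) ^ m * (Real.exp (-(m + 1) ^ 2) / (2 * (m + 2) ^ 2) * (N ^ 2)⁻¹ *
        Real.log (N / 2))) ≤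
      ∫⁻ v in {v | v j ≤ v i ∧ 0 ≤ v j} ∩ cube (m + 1), ENNReal.ofReal (v j * kernel N v) := by
  have hN0 : 0 < N := by linarith
  set c := Real.exp (-(m + 1) ^ 2) / (2 * (m + 2) ^ 2) * (N ^ 2)⁻¹ with hc
  have hc0 : 0 ≤ c := by positivity
  -- On this slab below the diagonal the exponential is bounded below. Its slices at fixed `v i` are
  -- cubes of volume `(1 / N) ^ m`, and integrating `1 / x` over `[2 / N, 1]` produces `log (N /
  -- 2)`.
  set E : Set (Fin (m + 1) → ℝ) :=
    {v | v i ∈ Icc (2 / N) 1 ∧ ∀ l, v l ∈ Icc (v i - 1 / N) (v i)} with hE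
  have hEm : MeasurableSet E := by
    have hEeq : E = (fun v => v i) ⁻¹' Icc (2 / N) 1 ∩
        ⋂ l, {v | v i - 1 / N ≤ v l} ∩ {v | v l ≤ v i} := by
      ext v
      simp [hE]
    rw [hEeq]
    exact (measurableSet_Icc.preimage (measurable_pi_apply i)).inter
      (MeasurableSet.iInter fun l => (measurableSet_le (by fun_prop) (by fun_prop)).inter
        (measurableSet_le (by fun_prop) (by fun_prop)))
  have hNN : 1 / N ≤ 2 / N := by gcongr; norm_num
  have hEsub : E ⊆ {v | v j ≤ v i ∧ 0 ≤ v j} ∩ cube (m + 1) := fun v hv => by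
    have h0 : ∀ l, 0 ≤ v l := fun l => by linarith [(hv.2 l).1, hv.1.1]
    exact ⟨⟨(hv.2 j).2, h0 j⟩, h0, fun l => (hv.2 l).2.trans hv.1.2⟩
  have hm : Measurable fun v : Fin (m + 1) → ℝ => ENNReal.ofReal (c * (v i)⁻¹) := by fun_prop
  calc ENNReal.ofReal ((1 / N) ^ m * (c * Real.log (N / 2)))
      = ∫⁻ x in Icc (2 / N) 1, ENNReal.ofReal (c * x⁻¹) * ENNReal.ofReal ((1 / N) ^ m) := by
        simp_rw [ENNReal.ofReal_mul hc0]
        rw [lintegral_mul_const' _ _ ENNReal.ofReal_ne_top,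
          lintegral_const_mul' _ _ ENNReal.ofReal_ne_top,
          lintegral_inv_Icc (by positivity) ((div_le_one hN0).2 hN), ← Real.log_inv, inv_div,
          ← ENNReal.ofReal_mul hc0, mul_comm, ENNReal.ofReal_mul
            (mul_nonneg hc0 (Real.log_nonneg ((one_le_div two_pos).2 hN)))]
    _ = ∫⁻ x, ∫⁻ w : Fin m → ℝ, E.indicator (fun v => ENNReal.ofReal (c * (v i)⁻¹))
          (i.insertNth x w) := by
        rw [← lintegral_indicator measurableSet_Icc]
        refine lintegral_congr fun x => ?_
        by_cases hx : x ∈ Icc (2 / N) 1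
        · have hvol : volume (Icc (fun _ : Fin m => x - 1 / N) fun _ => x) =
              ENNReal.ofReal ((1 / N) ^ m) := by
            rw [Real.volume_Icc_pi, ENNReal.ofReal_pow (by positivity)]
            simp
          rw [indicator_of_mem hx, ← hvol, ← lintegral_indicator_const measurableSet_Icc]
          refine lintegral_congr fun w => ?_
          have hiff : (i.insertNth x w : Fin (m + 1) → ℝ) ∈ E ↔
              w ∈ Icc (fun _ : Fin m => x - 1 / N) fun _ => x := by
            simp only [hE, mem_ofPred_eq, Fin.insertNth_apply_same, hx, true_and,
              Fin.forall_iff_succAbove i, Fin.insertNth_apply_succAbove]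
            simp only [mem_Icc, Pi.le_def, forall_and]
            simp [hN0.le]
          by_cases hw : w ∈ Icc (fun _ : Fin m => x - 1 / N) fun _ => x
          · rw [indicator_of_mem hw, indicator_of_mem (hiff.2 hw), Fin.insertNth_apply_same]
          · rw [indicator_of_notMem hw, indicator_of_notMem (hw ∘ hiff.1)]
        · rw [indicator_of_notMem hx]
          refine ((lintegral_congr fun w => indicator_of_notMem (fun hw => hx ?_) _).trans
            lintegral_zero).symm
          simpa using hw.1
    _ = ∫⁻ v in E, ENNReal.ofReal (c * (v i)⁻¹) := by
        rw [← lintegral_eq_lintegral_insertNth i (hm.indicator hEm), lintegral_indicator hEm]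
    _ ≤ ∫⁻ v in E, ENNReal.ofReal (v j * kernel N v) :=
        setLIntegral_mono' hEm fun v hv =>
          ENNReal.ofReal_le_ofReal (le_mul_kernel hN0 hv.1.1 hv.2 j)
    _ ≤ _ := lintegral_mono_set hEsub

end Estimates

/-! ### The normalized distribution and its two revenue bounds. -/

section Distribution

variable {n : ℕ} {N : ℝ}

/-- The integral of the kernel over the cube. -/
noncomputable def totalMass (n : ℕ) (N : ℝ) : ℝ := ∫ v in cube n, kernel N v

/-- The probability density proportional to the kernel. -/
noncomputable def kernelDensity (N : ℝ) (v : Fin n → ℝ) : ℝ := (totalMass n N)⁻¹ * kernel N v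

/-- The distribution on the cube with density proportional to the kernel. -/
noncomputable def kernelMeasure (n : ℕ) (N : ℝ) : Measure (Fin n → ℝ) :=
  (volume.restrict (cube n)).withDensity fun v => ENNReal.ofReal (kernelDensity N v)

lemma integrableOn_kernel (hN : 0 ≤ N) : IntegrableOn (kernel N) (cube n) :=
  (continuous_kernel hN).continuousOn.integrableOn_compact isCompact_Icc

lemma nonempty_interior_cube : (interior (cube n)).Nonempty := by
  refine ⟨fun _ => 1 / 2, mem_interior.2 ⟨univ.pi fun _ => Ioo 0 1, fun v hv => ?_,
    isOpen_set_pi finite_univ fun _ _ => isOpen_Ioo, fun _ _ => by norm_num⟩⟩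
  exact ⟨fun i => (hv i trivial).1.le, fun i => (hv i trivial).2.le⟩

/-- No estimate of the normalizing constant beyond positivity is needed, as its inverse multiplies
both revenue bounds. -/
lemma totalMass_pos (hN : 0 ≤ N) : 0 < totalMass n N := by
  rw [totalMass, setIntegral_pos_iff_support_of_nonneg_ae
    (Filter.Eventually.of_forall fun v => (kernel_pos hN v).le) (integrableOn_kernel hN)]
  have : Function.support (kernel N) ∩ cube n = cube n :=
    inter_eq_right.2 fun v _ => (kernel_pos hN v).ne'
  rw [this]
  exact (isOpen_interior.measure_pos volume nonempty_interior_cube).trans_le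
    (measure_mono interior_subset)

lemma kernelDensity_pos (hN : 0 ≤ N) (v : Fin n → ℝ) : 0 < kernelDensity N v :=
  mul_pos (inv_pos.2 (totalMass_pos hN)) (kernel_pos hN v)

lemma continuous_kernelDensity (hN : 0 ≤ N) : Continuous (kernelDensity (n := n) N) :=
  (continuous_kernel hN).const_mul _

lemma measurable_ofReal_kernelDensity (hN : 0 ≤ N) :
    Measurable fun v : Fin n → ℝ => ENNReal.ofReal (kernelDensity N v) :=
  (continuous_kernelDensity hN).measurable.ennreal_ofReal

lemma isProbabilityMeasure_kernelMeasure (hN : 0 ≤ N) :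
    IsProbabilityMeasure (kernelMeasure n N) := by
  refine ⟨?_⟩
  have hZ : 0 < totalMass n N := totalMass_pos hN
  rw [kernelMeasure, withDensity_apply _ MeasurableSet.univ, Measure.restrict_univ,
    ← ofReal_integral_eq_lintegral_ofReal (f := kernelDensity N)
      ((integrableOn_kernel hN).const_mul _)
      (Filter.Eventually.of_forall fun v => (kernelDensity_pos hN v).le)]
  simp only [kernelDensity]
  rw [integral_const_mul, ← totalMass, inv_mul_cancel₀ hZ.ne', ENNReal.ofReal_one]

/-- A positive density gives absolute continuity in both directions, so the support contains the
interior of the cube; being closed, it contains the cube, which is the closure of its interior by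
convexity. -/
lemma support_kernelMeasure (hN : 0 ≤ N) : (kernelMeasure n N).support = cube n := by
  have hclosed : IsClosed (cube n) := isClosed_Icc
  refine Subset.antisymm ?_ ?_
  · refine (withDensity_absolutelyContinuous _ _).support_mono.trans ?_
    exact Measure.support_restrict_subset.trans (inter_subset_left.trans hclosed.closure_eq.subset)
  · have h : interior (cube n) ⊆ (kernelMeasure n N).support := by
      refine Subset.trans ?_ (withDensity_absolutelyContinuous'
        (measurable_ofReal_kernelDensity hN).aemeasurable
        (ae_of_all _ fun v => by simpa using kernelDensity_pos hN v)).support_mono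
      refine Subset.trans ?_ Measure.interior_inter_support
      rw [Measure.support_eq_univ, inter_univ]
    have h2 := (convex_Icc (𝕜 := ℝ) (0 : Fin n → ℝ) 1).closure_interior_eq_closure_of_nonempty_interior
      nonempty_interior_cube
    rw [isClosed_Icc.closure_eq] at h2
    exact h2.symm.subset.trans (closure_minimal h Measure.isClosed_support)

lemma integrable_apply_kernelMeasure (hN : 0 ≤ N) (i : Fin n) :
    Integrable (fun v : Fin n → ℝ => v i) (kernelMeasure n N) := by
  have := isProbabilityMeasure_kernelMeasure (n := n) hN
  refine Integrable.of_bound (measurable_pi_apply i).aestronglyMeasurable 1 ?_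
  refine (withDensity_absolutelyContinuous _ _).ae_le ?_
  filter_upwards [ae_restrict_mem measurableSet_cube] with v hv
  rw [Real.norm_of_nonneg (hv.1 i)]
  exact hv.2 i

lemma kernelDensity_logConcave (hn : 2 ≤ n) (hN : 0 ≤ N) (i : Fin n) (v : Fin n → ℝ)
    (hv : v ∈ cube n) (x s d : ℝ) (hx : 0 ≤ x) (hd : 0 ≤ d) (hxs : x + d ≤ s) (hs : s ≤ 1) :
    kernelDensity N (Function.update v i s) * kernelDensity N (Function.update v i x) ≤
      kernelDensity N (Function.update v i (s - d)) *
        kernelDensity N (Function.update v i (x + d)) := by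
  simp only [kernelDensity, mul_mul_mul_comm (totalMass n N)⁻¹]
  exact mul_le_mul_of_nonneg_left (kernel_update_mul_le hn hN hv i hx hd hxs hs)
    (mul_self_nonneg _)

lemma isAffiliated_kernelDensity (hN : 0 ≤ N) : IsAffiliated (kernelDensity (n := n) N) := by
  intro v hv w hw
  rw [kernelDensity, kernelDensity, kernelDensity, kernelDensity, mul_mul_mul_comm,
    mul_mul_mul_comm _ (kernel N (v ⊓ w))]
  exact mul_le_mul_of_nonneg_left (kernel_mul_le_kernel_inf_mul_sup hN hv hw) (mul_self_nonneg _)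

lemma mul_kernelMeasure_le {m : ℕ} (hN : 0 < N) (i : Fin (m + 1)) {p : ℝ} (hp : 0 ≤ p) :
    ENNReal.ofReal p * kernelMeasure (m + 1) N {v | p ≤ v i} ≤
      ENNReal.ofReal ((totalMass (m + 1) N)⁻¹ * ((√Real.pi / N) ^ m * (N ^ 2)⁻¹)) := by
  have hZ : 0 < totalMass (m + 1) N := totalMass_pos hN.le
  have hS : MeasurableSet {v : Fin (m + 1) → ℝ | p ≤ v i} :=
    measurableSet_le measurable_const (measurable_pi_apply i)
  rw [kernelMeasure, withDensity_apply _ hS, Measure.restrict_restrict hS]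
  simp only [kernelDensity]
  simp_rw [ENNReal.ofReal_mul (inv_pos.2 hZ).le]
  rw [lintegral_const_mul' _ _ ENNReal.ofReal_ne_top, mul_left_comm]
  gcongr
  exact mul_lintegral_kernel_le hN i hp

lemma le_optimalRevenue_kernelMeasure {m k : ℕ} (hk : 1 ≤ k) (hm : 1 ≤ m) (hN : 2 ≤ N) :
    ENNReal.ofReal ((totalMass (m + 1) N)⁻¹ * ((1 / N) ^ m *
        (Real.exp (-(m + 1) ^ 2) / (2 * (m + 2) ^ 2) * (N ^ 2)⁻¹ * Real.log (N / 2)))) ≤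
      optimalRevenue (kernelMeasure (m + 1) N) k := by
  have hN0 : 0 ≤ N := by linarith
  have hZ : 0 < totalMass (m + 1) N := totalMass_pos hN0
  have hne : (0 : Fin (m + 1)) ≠ Fin.last m := by
    rw [ne_eq, Fin.ext_iff]
    simpa using (by omega : ¬ 0 = m)
  refine le_trans ?_ (lintegral_price_le_optimalRevenue hk hne _)
  have hS : MeasurableSet {v : Fin (m + 1) → ℝ | v (Fin.last m) ≤ v 0 ∧ 0 ≤ v (Fin.last m)} :=
    (measurableSet_le (measurable_pi_apply (Fin.last m)) (measurable_pi_apply 0)).inter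
      (measurableSet_le measurable_const (measurable_pi_apply (Fin.last m)))
  rw [kernelMeasure, setLIntegral_withDensity_eq_setLIntegral_mul _
    (measurable_ofReal_kernelDensity hN0) (by fun_prop) hS, Measure.restrict_restrict hS,
    ENNReal.ofReal_mul (inv_pos.2 hZ).le]
  refine (mul_le_mul_right (le_lintegral_mul_kernel hN 0 (Fin.last m)) _).trans ?_
  rw [← lintegral_const_mul' _ _ ENNReal.ofReal_ne_top]
  refine lintegral_mono fun v => le_of_eq ?_
  rw [Pi.mul_apply, ← ENNReal.ofReal_mul (inv_pos.2 hZ).le,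
    ← ENNReal.ofReal_mul (kernelDensity_pos hN0 v).le, kernelDensity]
  congr 1
  ring

end Distribution

/-- Both bounds carry the same power of `N` and the same normalization, so only `log (N / 2)`
against constants in `n` remains. Neither bound involves `k`, which lets one `N` serve every supply.
-/
lemma exists_revenue_lt (n : ℕ) (hn : 2 ≤ n) (α : ℝ) (hα : 0 < α) :
    ∃ N : ℝ, 0 ≤ N ∧ ∀ k : ℕ, 1 ≤ k → ∀ M : SequentialPostedPrice n,
      M.revenue (kernelMeasure n N) k <
        ENNReal.ofReal α * optimalRevenue (kernelMeasure n N) k := by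
  obtain ⟨m, rfl⟩ : ∃ m, n = m + 1 := ⟨n - 1, by omega⟩
  set K : ℕ := ∑ t ∈ Finset.range (m + 1), 2 ^ t * (m + 1) with hK
  set c : ℝ := Real.exp (-(m + 1) ^ 2) / (2 * (m + 2) ^ 2) with hc
  have hc0 : 0 < c := by positivity
  -- Chosen so that `α * c * T` exceeds the posted-price constant `K * √π ^ m` by `1`, the surplus
  -- that makes the inequality strict; `N = 2 * exp T` then turns `log (N / 2)` into `T`.
  set T : ℝ := (K * √Real.pi ^ m + 1) / (α * c) with hT
  have hT0 : 0 < T := by positivity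
  set N : ℝ := 2 * Real.exp T with hN
  have hN2 : 2 ≤ N := by linarith [Real.add_one_le_exp T]
  have hN0 : 0 < N := by linarith
  have hZ : 0 < totalMass (m + 1) N := totalMass_pos hN0.le
  have hlog : Real.log (N / 2) = T := by
    rw [hN, mul_div_cancel_left₀ _ two_ne_zero, Real.log_exp]
  have hαcT : α * c * T = K * √Real.pi ^ m + 1 := mul_div_cancel₀ _ (by positivity)
  refine ⟨N, hN0.le, fun k hk M => ?_⟩
  have := isProbabilityMeasure_kernelMeasure (n := m + 1) hN0.le
  refine (M.revenue_le _ k fun i p hp => mul_kernelMeasure_le hN0 i hp).trans_lt ?_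
  refine lt_of_lt_of_le ?_ (mul_le_mul_right
    (le_optimalRevenue_kernelMeasure hk (by omega) hN2) _)
  rw [← hK, ← ENNReal.ofReal_natCast, ← ENNReal.ofReal_mul (Nat.cast_nonneg _),
    ← ENNReal.ofReal_mul hα.le, hlog, ← hc]
  have key : α * ((totalMass (m + 1) N)⁻¹ * ((1 / N) ^ m * (c * (N ^ 2)⁻¹ * T))) =
      K * ((totalMass (m + 1) N)⁻¹ * ((√Real.pi / N) ^ m * (N ^ 2)⁻¹)) +
        (totalMass (m + 1) N)⁻¹ * ((1 / N) ^ m * (N ^ 2)⁻¹) := by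
    calc α * ((totalMass (m + 1) N)⁻¹ * ((1 / N) ^ m * (c * (N ^ 2)⁻¹ * T)))
        = (totalMass (m + 1) N)⁻¹ * ((1 / N) ^ m * (N ^ 2)⁻¹) * (α * c * T) := by ring
      _ = _ := by rw [hαcT, div_pow, div_pow, one_pow]; ring
  have hpos : 0 < (totalMass (m + 1) N)⁻¹ * ((1 / N) ^ m * (N ^ 2)⁻¹) := by positivity
  rw [key]
  refine (ENNReal.ofReal_lt_ofReal_iff (by positivity)).2 ?_
  linarith

end Posted

theorem mainTheorem8 (n : ℕ) (hn : 2 ≤ n) (α : ℝ) (hα : 0 < α) :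
    ∃ (π : Measure (Fin n → ℝ)) (f : (Fin n → ℝ) → ℝ),
      IsProbabilityMeasure π ∧ Posted.HasDensityOnCube π f ∧
      -- full support
      π.support = Posted.cube n ∧
      -- finite means
      (∀ i, Integrable (fun v : Fin n → ℝ => v i) π) ∧
      -- symmetry
      Posted.IsSymmetricDensity f ∧
      -- continuous and nowhere zero
      ContinuousOn f (Posted.cube n) ∧ (∀ v ∈ Posted.cube n, 0 < f v) ∧
      -- nowhere zero conditional densities
      (∀ i, ∀ v ∈ Posted.cube n, ∀ x ∈ Icc (0 : ℝ) 1, 0 < Posted.condDensity f i v x) ∧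
      Posted.HasMHR f ∧ Posted.IsRegular f ∧
      Posted.IsAffiliated f ∧
      -- no sequential posted price mechanism gets an `α` fraction of the optimal revenue
      ∀ k : ℕ, 1 ≤ k → ∀ M : Posted.SequentialPostedPrice n,
        M.revenue π k < ENNReal.ofReal α * Posted.optimalRevenue π k := by
  obtain ⟨N, hN, hrev⟩ := Posted.exists_revenue_lt n hn α hα
  have hcont := Posted.continuous_kernelDensity (n := n) hN
  have hpos := Posted.kernelDensity_pos (n := n) hN
  have hlc := Posted.kernelDensity_logConcave hn hN
  exact ⟨Posted.kernelMeasure n N, Posted.kernelDensity N,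
    Posted.isProbabilityMeasure_kernelMeasure hN, rfl, Posted.support_kernelMeasure hN,
    Posted.integrable_apply_kernelMeasure hN,
    fun σ v _ => congrArg (_ * ·) (Posted.kernel_comp_perm σ v), hcont.continuousOn,
    fun v _ => hpos v, fun i v _ x _ => Posted.condDensity_pos hcont hpos i v x,
    Posted.hasMHR_of_logConcave hcont hpos hlc, Posted.isRegular_of_logConcave hcont hpos hlc,
    Posted.isAffiliated_kernelDensity hN, hrev⟩
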